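/- On $\mathbb R^{2+1}$, with points $(t,x)$ and dual (angular frequency) variables $(\tau,\xi)\in\mathbb R\times\mathbb R^2$, let $\Lambda^\alpha$, $\Lambda_-^\alpha$, $D_+$, $D_-$ be the Fourier multiplier operators with symbols $$(1+|\xi|^2)^{\alpha/2},\qquad \Bigl(1+\tfrac{(\tau^2-|\xi|^2)^2}{1+\tau^2+|\xi|^2}\Bigr)^{\alpha/2},\qquad (\tau^2+|\xi|^2)^{1/2},\qquad \tfrac{|\tau^2-|\xi|^2|}{(\tau^2+|\xi|^2)^{1/2}},$$ and for tempered distributions $u$ on $\mathbb R^{2+1}$ put $$\|u\|_{H^{s,\theta}}=\|\Lambda^s\Lambda_-^\theta u\|_{L^2(\mathbb R^{2+1})},\qquad \|u\|_{\mathcal H^{s,\theta}}=\|u\|_{H^{s,\theta}}+\|\partial_t u\|_{H^{s-1,\theta}}$$ (the $H^{s,\theta}$ norm is $+\infty$ if $\hat u$ is not a function or $\Lambda^s\Lambda_-^\theta u\notin L^2$). **Theorem.** Let $s>0$, $\max(\tfrac12,1-s)<\theta<1$ and $0\le\varepsilon\le 1-\theta$. There is a constant $C>0$, depending only on $s,\theta,\varepsilon$,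 such that for all complex-valued $\varphi,\psi$ with $\|\varphi\|_{\mathcal H^{s+1,\theta}}<\infty$ and $\|\psi\|_{\mathcal H^{s+1,\theta}}<\infty$, the distributions $D_+\varphi$ and $D_-\psi$ belong to $L^2(\mathbb R^{2+1})$ (so that their product is a well-defined $L^1$ function) and $$\|D_+\varphi\, D_-\psi\|_{H^{s,\theta-1+\varepsilon}}\le C\,\|\varphi\|_{\mathcal H^{s+1,\theta}}\,\|\psi\|_{\mathcal H^{s+1,\theta}}.$$ -/

import Mathlib

open MeasureTheory
open scoped SchwartzMap FourierTransform LineDeriv ENNReal NNReal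

noncomputable section

namespace WaveSobolev

/-- Minkowski space `ℝ^{2+1}` with coordinates `(t, x₁, x₂)`, and also the dual space of
frequencies with coordinates `(τ, ξ₁, ξ₂)`.  The Euclidean structure is the one used by the
Fourier transform and Lebesgue measure. -/
abbrev Spacetime : Type := EuclideanSpace ℝ (Fin 3)

/-- The square `τ²` of the time frequency. -/
def timeSq (ζ : Spacetime) : ℝ := ζ 0 ^ 2

/-- The square `|ξ|²` of the length of the spatial frequency. -/
def spaceSq (ζ : Spacetime) : ℝ := ζ 1 ^ 2 + ζ 2 ^ 2

/-- The symbol `(1 + |ξ|²)^{α/2}` of `Λ^α`. -/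
def symbolΛ (α : ℝ) (ζ : Spacetime) : ℝ := (1 + spaceSq ζ) ^ (α / 2)

/-- The symbol `(1 + (τ² - |ξ|²)² / (1 + τ² + |ξ|²))^{α/2}` of `Λ₋^α`. -/
def symbolΛminus (α : ℝ) (ζ : Spacetime) : ℝ :=
  (1 + (timeSq ζ - spaceSq ζ) ^ 2 / (1 + timeSq ζ + spaceSq ζ)) ^ (α / 2)

/-- The symbol `(τ² + |ξ|²)^{1/2}` of `D₊`. -/
def symbolDplus (ζ : Spacetime) : ℝ := Real.sqrt (timeSq ζ + spaceSq ζ)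

/-- The symbol `|τ² - |ξ|²| / (τ² + |ξ|²)^{1/2}` of `D₋` (its value at the single
frequency `0` is irrelevant). -/
def symbolDminus (ζ : Spacetime) : ℝ :=
  |timeSq ζ - spaceSq ζ| / Real.sqrt (timeSq ζ + spaceSq ζ)

/-- The Fourier transform of the tempered distribution `u` is (given by integration against)
the measurable function `g`. -/
def HasFourierDensity (u : 𝓢'(Spacetime, ℂ)) (g : Spacetime → ℂ) : Prop :=
  AEStronglyMeasurable g volume ∧
    ∀ χ : 𝓢(Spacetime, ℂ), Integrable (fun ζ => χ ζ * g ζ) volume ∧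
      (𝓕 u) χ = ∫ ζ, χ ζ * g ζ

/-- `v` is the image of `u` under the Fourier multiplier operator with symbol `m`: the
Fourier transforms of `u` and `v` are functions and `v̂ = m û`.  The symbol is a function of
the angular frequency `(τ, ξ)`; Mathlib's Fourier transform `∫ exp (-2πi⟨x, ζ⟩) f x dx`
corresponds to the angular frequency `2π ζ`. -/
def IsMultiplierImage (m : Spacetime → ℝ) (u v : 𝓢'(Spacetime, ℂ)) : Prop :=
  ∃ g : Spacetime → ℂ, HasFourierDensity u g ∧
    HasFourierDensity v (fun ζ => (m ((2 * Real.pi) • ζ) : ℂ) * g ζ)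

/-- An `L²` function on space-time as a tempered distribution. -/
def ofL2 (f : Lp ℂ 2 (volume : Measure Spacetime)) : 𝓢'(Spacetime, ℂ) :=
  Lp.toTemperedDistribution f

/-- The (pointwise) product of two `L²` functions, an `L¹` function, as a tempered
distribution. -/
def mulL2 (f g : Lp ℂ 2 (volume : Measure Spacetime)) : 𝓢'(Spacetime, ℂ) :=
  Lp.toTemperedDistribution (f • g : Lp ℂ 1 (volume : Measure Spacetime))

/-- The norm `‖u‖_{H^{s,θ}} = ‖Λ^s Λ₋^θ u‖_{L²(ℝ^{2+1})}`, with value `∞` if `Λ^s Λ₋^θ u`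
is not an `L²` function.  There is at most one `f` over which the infimum is taken. -/
def normH (s θ : ℝ) (u : 𝓢'(Spacetime, ℂ)) : ℝ≥0∞ :=
  ⨅ (f : Lp ℂ 2 (volume : Measure Spacetime))
    (_ : IsMultiplierImage (fun ζ => symbolΛ s ζ * symbolΛminus θ ζ) u (ofL2 f)), ‖f‖ₑ

/-- The distributional time derivative `∂_t u`. -/
def timeDeriv (u : 𝓢'(Spacetime, ℂ)) : 𝓢'(Spacetime, ℂ) :=
  ∂_{(EuclideanSpace.single (0 : Fin 3) (1 : ℝ) : Spacetime)} u

/-- The norm `‖u‖_{𝓗^{s,θ}} = ‖u‖_{H^{s,θ}} + ‖∂_t u‖_{H^{s-1,θ}}`. -/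
def normCalH (s θ : ℝ) (u : 𝓢'(Spacetime, ℂ)) : ℝ≥0∞ :=
  normH s θ u + normH (s - 1) θ (timeDeriv u)

end WaveSobolev

end

/-!
The weight `Λ₋^{θ-1+ε}` is at most `1` because `θ - 1 + ε ≤ 0`, so it suffices to bound the product
in `H^{s,0}`.

On the Fourier side the two terms of the `𝓗^{s+1,θ}` norm together control the symbol
`Λ^s Λ₋^θ (1 + τ² + |ξ|²)^{1/2}`.  Hence `D₊φ ∈ H^{s,θ}` (`symbol_mul_symbolDplus_le`).  Moreover
`D₋ ≤ Λ₋ ≤ (1 + τ² + |ξ|²)^{1/2}` pointwise, so `Λ^θ D₋ ≤ (1 + τ² + |ξ|²)^{1/2} Λ₋^θ`, and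
`D₋ψ ∈ H^{s+θ,0}` (`symbolΛ_mul_symbolDminus_le`).  What remains is the product estimate
`H^{s,θ} · H^{s+θ,0} → H^{s,0}`.

The Fourier transform of a product of `L²` functions is the convolution of their Fourier transforms
(`hasFourierDensity_mulL2`).  Writing `⟨ξ⟩` for `(1 + |ξ|²)^{1/2}`, the inequality
`⟨ξ⟩^s ≲ ⟨ξ₁⟩^s ⟨ξ₂⟩^{s+θ} (⟨ξ₁⟩^{-(s+θ)} + ⟨ξ₂⟩^{-(s+θ)})` for `ξ = ξ₁ + ξ₂` bounds the weighted
convolution by one with kernel `Λ₋(ζ₁)^{-θ} (⟨ξ₁⟩^{-(s+θ)} + ⟨ξ₂⟩^{-(s+θ)})`.  Its square is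
integrable in `ζ₁`, uniformly in the output frequency: `Λ₋^{-2θ}` is integrable in `τ` uniformly in
`ξ` as `θ > 1/2`, and `⟨ξ⟩^{-2(s+θ)}` is integrable on `ℝ²` as `s + θ > 1`
(`exists_lintegral_kernelSq_le`).  The Cauchy–Schwarz inequality and Tonelli's theorem then give the
`L²` bound (`exists_lintegral_convolution_le`).

The rest transfers this to the distributional norms: a Fourier density is unique almost everywhere,
the time derivative multiplies it by `iτ`, and Plancherel's theorem identifies the norms.
-/

noncomputable section

namespace WaveSobolev

/-! ### The Fourier transform of a product of two square integrable functions -/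

section FourierOfProduct

variable {E : Type*} [NormedAddCommGroup E] [InnerProductSpace ℝ E] [FiniteDimensional ℝ E]
  [MeasurableSpace E] [BorelSpace E]

/-- The convolution theorem for a product of Schwartz functions. -/
theorem integral_fourier_mul_fourier_schwartz (f g : 𝓢(E, ℂ)) (ζ : E) :
    ∫ η, 𝓕 f η * 𝓕 g (ζ - η) = 𝓕 (fun x => f x * g x) ζ := by
  have h1 := SchwartzMap.convolution_apply (ContinuousLinearMap.mul ℂ ℂ) (𝓕 f) (𝓕 g) ζ
  have h2 : SchwartzMap.convolution (ContinuousLinearMap.mul ℂ ℂ) (𝓕 f) (𝓕 g) =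
      𝓕 (SchwartzMap.pairing (ContinuousLinearMap.mul ℂ ℂ) f g) := by
    suffices h : (𝓕⁻ (SchwartzMap.convolution (ContinuousLinearMap.mul ℂ ℂ) (𝓕 f) (𝓕 g)) :
        𝓢(E, ℂ)) = SchwartzMap.pairing (ContinuousLinearMap.mul ℂ ℂ) f g by
      rw [← h, FourierTransform.fourier_fourierInv_eq]
    ext x
    rw [SchwartzMap.fourierInv_coe, Real.fourierInv_eq_fourier_neg, ← SchwartzMap.fourier_coe,
      SchwartzMap.fourier_convolution]
    have (u : 𝓢(E, ℂ)) : 𝓕 (𝓕 u) (-x) = u x := by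
      have h0 : (𝓕⁻ (𝓕 u : 𝓢(E, ℂ)) : 𝓢(E, ℂ)) = u := FourierTransform.fourierInv_fourier_eq u
      conv_rhs => rw [← h0]
      rw [SchwartzMap.fourierInv_coe, Real.fourierInv_eq_fourier_neg, ← SchwartzMap.fourier_coe]
    simp [this]
  rw [h2, SchwartzMap.fourier_coe] at h1
  simp only [convolution_def, ContinuousLinearMap.mul_apply'] at h1
  rw [← h1]
  congr 1

theorem measurePreserving_const_sub (ζ : E) :
    MeasurePreserving (fun η : E => ζ - η) volume volume :=
  Measure.measurePreserving_sub_left volume ζ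

/-- The Fourier integral of a product of two square integrable functions is, at every frequency,
the convolution of their `L²` Fourier transforms.  For Schwartz functions this is the convolution
theorem; both sides are continuous on `L² × L²`. -/
theorem integral_fourier_mul_fourier_L2 (f g : Lp ℂ 2 (volume : Measure E)) (ζ : E) :
    ∫ η, (𝓕 f : Lp ℂ 2 (volume : Measure E)) η * (𝓕 g : Lp ℂ 2 (volume : Measure E)) (ζ - η) =
      𝓕 (fun x => f x * g x) ζ := by
  have hm := measurePreserving_const_sub ζ
  let R := Lp.compMeasurePreservingₗᵢ (E := ℂ) (p := 2) ℂ (fun η : E => ζ - η) hm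
  -- Both sides are rewritten through the continuous bilinear Hölder pairings.
  have hB (F G : Lp ℂ 2 (volume : Measure E)) :
      ContinuousLinearMap.lpPairing volume 2 2 (ContinuousLinearMap.mul ℂ ℂ) F (R G) =
        ∫ η, F η * G (ζ - η) := by
    rw [ContinuousLinearMap.lpPairing_eq_integral]
    refine integral_congr_ae ?_
    filter_upwards [Lp.coeFn_compMeasurePreserving G hm] with η hη
    have : (R G : E → ℂ) η = G (ζ - η) := hη
    simp [this]
  have hφ : MemLp (fun x : E => ((Real.fourierChar (-inner ℝ x ζ) : Circle) : ℂ)) ∞ volume :=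
    memLp_top_of_bound (by fun_prop) 1
      (.of_forall fun x => (Circle.norm_coe _).le)
  have hA (f g : Lp ℂ 2 (volume : Measure E)) :
      ContinuousLinearMap.lpPairing volume ∞ 1 (ContinuousLinearMap.mul ℂ ℂ) hφ.toLp
        (ContinuousLinearMap.holderL volume 2 2 1 (ContinuousLinearMap.mul ℂ ℂ) f g) =
        𝓕 (fun x => f x * g x) ζ := by
    rw [ContinuousLinearMap.lpPairing_eq_integral, Real.fourier_eq]
    refine integral_congr_ae ?_
    filter_upwards [hφ.coeFn_toLp, ContinuousLinearMap.coeFn_holder (r := 1)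
      (ContinuousLinearMap.mul ℂ ℂ) f g] with x h1 h2
    have : (ContinuousLinearMap.holderL volume 2 2 1 (ContinuousLinearMap.mul ℂ ℂ) f g : E → ℂ) x
      = f x * g x := h2
    rw [this, h1, Circle.smul_def]
    rfl
  rw [← hB, ← hA]
  refine DenseRange.induction_on₂ (p := fun f g : Lp ℂ 2 (volume : Measure E) =>
    ContinuousLinearMap.lpPairing volume 2 2 (ContinuousLinearMap.mul ℂ ℂ) (𝓕 f) (R (𝓕 g)) =
    ContinuousLinearMap.lpPairing volume ∞ 1 (ContinuousLinearMap.mul ℂ ℂ) hφ.toLp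
        (ContinuousLinearMap.holderL volume 2 2 1 (ContinuousLinearMap.mul ℂ ℂ) f g))
    (SchwartzMap.denseRange_toLpCLM (E := E) (F := ℂ) (p := 2) (μ := volume)
      ENNReal.ofNat_ne_top) ?_ ?_ f g
  · refine isClosed_eq ?_ ?_
    · have c1 : Continuous fun q : Lp ℂ 2 (volume : Measure E) × Lp ℂ 2 (volume : Measure E) =>
          (𝓕 q.1 : Lp ℂ 2 (volume : Measure E)) :=
        (Lp.fourierTransformₗᵢ E ℂ).continuous.comp continuous_fst
      have c2 : Continuous fun q : Lp ℂ 2 (volume : Measure E) × Lp ℂ 2 (volume : Measure E) =>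
          R (𝓕 q.2 : Lp ℂ 2 (volume : Measure E)) :=
        R.continuous.comp ((Lp.fourierTransformₗᵢ E ℂ).continuous.comp continuous_snd)
      fun_prop
    · fun_prop
  · intro u v
    rw [hB, hA, SchwartzMap.toLpCLM_apply, SchwartzMap.toLpCLM_apply, SchwartzMap.toLp_fourier_eq,
      SchwartzMap.toLp_fourier_eq]
    calc _ = ∫ η, 𝓕 u η * 𝓕 v (ζ - η) := by
          refine integral_congr_ae ?_
          filter_upwards [(𝓕 u).coeFn_toLp 2 volume,
            hm.quasiMeasurePreserving.ae ((𝓕 v).coeFn_toLp 2 volume)] with η h1 h2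
          rw [h1, h2]
      _ = 𝓕 (fun x => u x * v x) ζ := integral_fourier_mul_fourier_schwartz u v ζ
      _ = _ := by
          rw [Real.fourier_eq, Real.fourier_eq]
          refine integral_congr_ae ?_
          filter_upwards [u.coeFn_toLp 2 volume, v.coeFn_toLp 2 volume] with x h1 h2
          rw [h1, h2]

end FourierOfProduct

/-! ### Tempered distributions whose Fourier transform is a function -/

section Density

theorem HasFourierDensity.locallyIntegrable {u : 𝓢'(Spacetime, ℂ)} {g : Spacetime → ℂ}
    (h : HasFourierDensity u g) : LocallyIntegrable g volume := by
  intro x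
  let b : ContDiffBump x := ⟨1, 2, one_pos, one_lt_two⟩
  have hg₁ : HasCompactSupport (Complex.ofRealCLM ∘ b) := b.hasCompactSupport.comp_left rfl
  have hg₂ : ContDiff ℝ ((⊤ : ℕ∞) : WithTop ℕ∞) (Complex.ofRealCLM ∘ b) :=
    Complex.ofRealCLM.contDiff.comp b.contDiff
  refine ⟨Metric.closedBall x 1, Metric.closedBall_mem_nhds x one_pos, ?_⟩
  refine (h.2 (hg₁.toSchwartzMap hg₂)).1.integrableOn.congr_fun (fun ζ hζ => ?_)
    Metric.isClosed_closedBall.measurableSet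
  have : b ζ = 1 := b.one_of_mem_closedBall hζ
  simp [this]

/-- The Fourier density of a tempered distribution is unique almost everywhere. -/
theorem HasFourierDensity.ae_eq {u : 𝓢'(Spacetime, ℂ)} {g g' : Spacetime → ℂ}
    (h : HasFourierDensity u g) (h' : HasFourierDensity u g') : g =ᵐ[volume] g' := by
  refine ae_eq_of_integral_contDiff_smul_eq h.locallyIntegrable h'.locallyIntegrable ?_
  intro χ hχ hχc
  have hg₁ : HasCompactSupport (Complex.ofRealCLM ∘ χ) := hχc.comp_left rfl
  have hg₂ : ContDiff ℝ ((⊤ : ℕ∞) : WithTop ℕ∞) (Complex.ofRealCLM ∘ χ) :=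
    Complex.ofRealCLM.contDiff.comp hχ
  have := (h.2 (hg₁.toSchwartzMap hg₂)).2.symm.trans (h'.2 (hg₁.toSchwartzMap hg₂)).2
  simpa using this

theorem HasFourierDensity.congr {u : 𝓢'(Spacetime, ℂ)} {g g' : Spacetime → ℂ}
    (h : HasFourierDensity u g) (hg : g =ᵐ[volume] g') : HasFourierDensity u g' := by
  refine ⟨h.1.congr hg, fun χ => ?_⟩
  have : (fun ζ => χ ζ * g ζ) =ᵐ[volume] fun ζ => χ ζ * g' ζ := by
    filter_upwards [hg] with ζ hζ
    rw [hζ]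
  exact ⟨(h.2 χ).1.congr this, (h.2 χ).2.trans (integral_congr_ae this)⟩

theorem hasFourierDensity_ofL2 (f : Lp ℂ 2 (volume : Measure Spacetime)) :
    HasFourierDensity (ofL2 f) (𝓕 f : Lp ℂ 2 (volume : Measure Spacetime)) := by
  refine ⟨Lp.aestronglyMeasurable _, fun χ => ⟨?_, ?_⟩⟩
  · exact (χ.memLp 2 volume).integrable_mul (Lp.memLp _)
  · rw [ofL2, Lp.fourier_toTemperedDistribution_eq, Lp.toTemperedDistribution_apply]
    rfl

/-- The Fourier transform of a product of two `L²` functions is the convolution of their Fourier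
transforms. -/
theorem hasFourierDensity_mulL2 (f g : Lp ℂ 2 (volume : Measure Spacetime)) :
    HasFourierDensity (mulL2 f g) (fun ζ => ∫ η, (𝓕 f : Lp ℂ 2 (volume : Measure Spacetime)) η *
      (𝓕 g : Lp ℂ 2 (volume : Measure Spacetime)) (ζ - η)) := by
  have hfg : Integrable (fun x => f x * g x) volume := (Lp.memLp f).integrable_mul (Lp.memLp g)
  have hc : Continuous (𝓕 fun x => f x * g x) :=
    VectorFourier.fourierIntegral_continuous Real.continuous_fourierChar continuous_inner hfg
  have hb (ζ : Spacetime) : ‖𝓕 (fun x => f x * g x) ζ‖ ≤ ∫ x, ‖f x * g x‖ :=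
    VectorFourier.norm_fourierIntegral_le_integral_norm _ _ _ _ _
  simp_rw [integral_fourier_mul_fourier_L2]
  refine ⟨hc.aestronglyMeasurable, fun χ => ⟨?_, ?_⟩⟩
  · exact χ.integrable.mul_bdd hc.aestronglyMeasurable (.of_forall hb)
  · rw [TemperedDistribution.fourier_apply, mulL2, Lp.toTemperedDistribution_apply]
    have := VectorFourier.integral_fourierIntegral_smul_eq_flip (L := innerₗ Spacetime)
      Real.continuous_fourierChar continuous_inner χ.integrable hfg (μ := volume) (ν := volume)
    rw [flip_innerₗ] at this
    refine Eq.trans ?_ this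
    refine integral_congr_ae ?_
    filter_upwards [Lp.coeFn_lpSMul (r := 1) f g] with x hx
    rw [hx]
    rfl

/-- The time derivative acts on the Fourier side as multiplication by `i τ`, where `τ = 2π ζ₀` is
the angular time frequency. -/
theorem HasFourierDensity.timeDeriv {u : 𝓢'(Spacetime, ℂ)} {g : Spacetime → ℂ}
    (h : HasFourierDensity u g) :
    HasFourierDensity (timeDeriv u) (fun ζ => Complex.I * ((2 * Real.pi * ζ 0 : ℝ) : ℂ) * g ζ) := by
  have hm : (fun ζ : Spacetime => ((inner ℝ ζ (EuclideanSpace.single (0 : Fin 3) (1 : ℝ)) : ℝ) : ℂ)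
    ).HasTemperateGrowth := by fun_prop
  refine ⟨?_, fun χ => ?_⟩
  · refine AEStronglyMeasurable.mul ?_ h.1
    exact Continuous.aestronglyMeasurable (by fun_prop)
  · have hχ := h.2 ((2 * Real.pi * Complex.I) • SchwartzMap.smulLeftCLM ℂ (fun ζ : Spacetime =>
      ((inner ℝ ζ (EuclideanSpace.single (0 : Fin 3) (1 : ℝ)) : ℝ) : ℂ)) χ)
    have heq : (fun ζ => ((2 * Real.pi * Complex.I) • SchwartzMap.smulLeftCLM ℂ
        (fun ζ : Spacetime =>
        ((inner ℝ ζ (EuclideanSpace.single (0 : Fin 3) (1 : ℝ)) : ℝ) : ℂ)) χ) ζ * g ζ) =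
        fun ζ => χ ζ * (Complex.I * ((2 * Real.pi * ζ 0 : ℝ) : ℂ) * g ζ) := by
      ext ζ
      rw [_root_.smul_apply, SchwartzMap.smulLeftCLM_apply_apply hm,
        EuclideanSpace.inner_single_right]
      simp
      ring
    rw [heq] at hχ
    refine ⟨hχ.1, ?_⟩
    rw [← hχ.2, WaveSobolev.timeDeriv, TemperedDistribution.fourier_lineDerivOp_eq, map_smul]
    rfl

end Density

/-! ### Pointwise inequalities between the symbols -/

section SymbolInequalities

/-- The symbol `1 + (τ² - |ξ|²)² / (1 + τ² + |ξ|²)` of `Λ₋²`, comparable to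
`1 + (|τ| - |ξ|)²`. -/
def coneWeight (ζ : Spacetime) : ℝ :=
  1 + (timeSq ζ - spaceSq ζ) ^ 2 / (1 + timeSq ζ + spaceSq ζ)

theorem timeSq_nonneg (ζ : Spacetime) : 0 ≤ timeSq ζ := sq_nonneg _

theorem spaceSq_nonneg (ζ : Spacetime) : 0 ≤ spaceSq ζ := by unfold spaceSq; positivity

theorem one_le_coneWeight (ζ : Spacetime) : 1 ≤ coneWeight ζ := by
  have := timeSq_nonneg ζ
  have := spaceSq_nonneg ζ
  unfold coneWeight
  have : 0 ≤ (timeSq ζ - spaceSq ζ) ^ 2 / (1 + timeSq ζ + spaceSq ζ) := by positivity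
  linarith

theorem coneWeight_le (ζ : Spacetime) : coneWeight ζ ≤ 1 + timeSq ζ + spaceSq ζ := by
  have ht := timeSq_nonneg ζ
  have hx := spaceSq_nonneg ζ
  have : (timeSq ζ - spaceSq ζ) ^ 2 / (1 + timeSq ζ + spaceSq ζ) ≤ timeSq ζ + spaceSq ζ := by
    rw [div_le_iff₀ (by positivity)]
    nlinarith [mul_nonneg ht hx]
  unfold coneWeight
  linarith

theorem symbolΛ_pos (α : ℝ) (ζ : Spacetime) : 0 < symbolΛ α ζ := by
  have := spaceSq_nonneg ζ
  unfold symbolΛ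
  positivity

theorem one_le_symbolΛ {α : ℝ} (hα : 0 ≤ α) (ζ : Spacetime) : 1 ≤ symbolΛ α ζ :=
  Real.one_le_rpow (by linarith [spaceSq_nonneg ζ]) (by positivity)

theorem symbolΛminus_pos (α : ℝ) (ζ : Spacetime) : 0 < symbolΛminus α ζ :=
  Real.rpow_pos_of_pos (zero_lt_one.trans_le (one_le_coneWeight ζ)) _

theorem one_le_symbolΛminus {α : ℝ} (hα : 0 ≤ α) (ζ : Spacetime) : 1 ≤ symbolΛminus α ζ :=
  Real.one_le_rpow (one_le_coneWeight ζ) (by positivity)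

theorem symbolΛminus_le_one {α : ℝ} (hα : α ≤ 0) (ζ : Spacetime) : symbolΛminus α ζ ≤ 1 :=
  Real.rpow_le_one_of_one_le_of_nonpos (one_le_coneWeight ζ) (by linarith)

theorem symbolDplus_nonneg (ζ : Spacetime) : 0 ≤ symbolDplus ζ := Real.sqrt_nonneg _

theorem symbolDminus_nonneg (ζ : Spacetime) : 0 ≤ symbolDminus ζ := by
  unfold symbolDminus; positivity

theorem symbolΛ_sq (α : ℝ) (ζ : Spacetime) : symbolΛ α ζ ^ 2 = (1 + spaceSq ζ) ^ α := by
  have := spaceSq_nonneg ζ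
  rw [symbolΛ, ← Real.rpow_natCast, ← Real.rpow_mul (by positivity)]
  congr 1
  push_cast
  ring

theorem symbolΛminus_sq (α : ℝ) (ζ : Spacetime) : symbolΛminus α ζ ^ 2 = coneWeight ζ ^ α := by
  have := one_le_coneWeight ζ
  change (coneWeight ζ ^ (α / 2)) ^ 2 = _
  rw [← Real.rpow_natCast, ← Real.rpow_mul (by positivity)]
  congr 1
  push_cast
  ring

theorem symbolΛ_add (α β : ℝ) (ζ : Spacetime) :
    symbolΛ (α + β) ζ = symbolΛ α ζ * symbolΛ β ζ := by
  have := spaceSq_nonneg ζ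
  rw [symbolΛ, symbolΛ, symbolΛ, ← Real.rpow_add (by positivity)]
  congr 1
  ring

theorem sqrt_one_add_spaceSq (ζ : Spacetime) : √(1 + spaceSq ζ) = symbolΛ 1 ζ :=
  Real.sqrt_eq_rpow _

/-- `(1 + τ² + |ξ|²)^{1/2} ≤ Λ + |τ|`: the bound through which the two terms of the `𝓗` norm
control a full derivative. -/
theorem sqrt_le_symbolΛ_one_add_abs (ζ : Spacetime) :
    √(1 + timeSq ζ + spaceSq ζ) ≤ symbolΛ 1 ζ + |ζ 0| := by
  rw [← sqrt_one_add_spaceSq]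
  have h1 : √(1 + spaceSq ζ) ^ 2 = 1 + spaceSq ζ :=
    Real.sq_sqrt (by linarith [spaceSq_nonneg ζ])
  have h2 : |ζ 0| ^ 2 = timeSq ζ := sq_abs _
  refine Real.sqrt_le_iff.2 ⟨by positivity, ?_⟩
  nlinarith [mul_nonneg (Real.sqrt_nonneg (1 + spaceSq ζ)) (abs_nonneg (ζ 0))]

/-- The pointwise form of `D₊ : 𝓗^{s+1,θ} → H^{s,θ}`. -/
theorem symbol_mul_symbolDplus_le (s θ : ℝ) (ζ : Spacetime) :
    symbolΛ s ζ * symbolΛminus θ ζ * symbolDplus ζ ≤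
      symbolΛ (s + 1) ζ * symbolΛminus θ ζ + symbolΛ s ζ * symbolΛminus θ ζ * |ζ 0| := by
  have h : symbolDplus ζ ≤ symbolΛ 1 ζ + |ζ 0| :=
    (Real.sqrt_le_sqrt (by linarith)).trans (sqrt_le_symbolΛ_one_add_abs ζ)
  have h0 := mul_pos (symbolΛ_pos s ζ) (symbolΛminus_pos θ ζ)
  rw [symbolΛ_add]
  nlinarith [mul_le_mul_of_nonneg_left h h0.le]

theorem symbolDminus_le_sqrt_coneWeight (ζ : Spacetime) : symbolDminus ζ ≤ √(coneWeight ζ) := by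
  have ht := timeSq_nonneg ζ
  have hx := spaceSq_nonneg ζ
  refine Real.le_sqrt_of_sq_le ?_
  rw [symbolDminus, div_pow, sq_abs, Real.sq_sqrt (by positivity), coneWeight]
  rcases (add_nonneg ht hx).eq_or_lt with h | h
  · rw [← h, div_zero]
    positivity
  · have e : (1 : ℝ) + timeSq ζ + spaceSq ζ = 1 + (timeSq ζ + spaceSq ζ) := by ring
    rw [e]
    set p := timeSq ζ + spaceSq ζ with hp
    have hq : (timeSq ζ - spaceSq ζ) ^ 2 ≤ p ^ 2 := by
      rw [hp]; nlinarith [mul_nonneg ht hx]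
    set q := (timeSq ζ - spaceSq ζ) ^ 2
    rw [div_le_iff₀ h, add_mul, one_mul, div_mul_eq_mul_div, ← sub_le_iff_le_add', le_div_iff₀
      (by linarith)]
    nlinarith

/-- The pointwise form of `D₋ : 𝓗^{s+1,θ} → H^{s+θ,0}`.  Since `D₋ ≤ Λ₋`, the operator `D₋` costs
`Λ₋^{1-θ}` beyond the available `Λ₋^θ`, which is paid for by `1 - θ` of the full derivative. -/
theorem symbolΛ_mul_symbolDminus_le (s : ℝ) {θ : ℝ} (hθ0 : 0 ≤ θ) (hθ1 : θ ≤ 1) (ζ : Spacetime) :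
    symbolΛ (s + θ) ζ * symbolDminus ζ ≤
      symbolΛ (s + 1) ζ * symbolΛminus θ ζ + symbolΛ s ζ * symbolΛminus θ ζ * |ζ 0| := by
  have ht := timeSq_nonneg ζ
  have hx := spaceSq_nonneg ζ
  have hw := one_le_coneWeight ζ
  have hle : symbolΛ θ ζ * symbolDminus ζ ≤ (symbolΛ 1 ζ + |ζ 0|) * symbolΛminus θ ζ :=
    calc symbolΛ θ ζ * symbolDminus ζ
        ≤ (1 + timeSq ζ + spaceSq ζ) ^ (θ / 2) *
          ((1 + timeSq ζ + spaceSq ζ) ^ ((1 - θ) / 2) * coneWeight ζ ^ (θ / 2)) := by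
          refine mul_le_mul ?_ ((symbolDminus_le_sqrt_coneWeight ζ).trans ?_)
            (symbolDminus_nonneg ζ) (by positivity)
          · exact Real.rpow_le_rpow (by positivity) (by linarith) (by positivity)
          · rw [Real.sqrt_eq_rpow, show (1 / 2 : ℝ) = (1 - θ) / 2 + θ / 2 by ring,
              Real.rpow_add (by positivity)]
            gcongr
            exact coneWeight_le ζ
      _ = √(1 + timeSq ζ + spaceSq ζ) * symbolΛminus θ ζ := by
          rw [← mul_assoc, ← Real.rpow_add (by positivity), Real.sqrt_eq_rpow]
          congr 2
          ring
      _ ≤ _ := mul_le_mul_of_nonneg_right (sqrt_le_symbolΛ_one_add_abs ζ) (symbolΛminus_pos θ ζ).le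
  rw [symbolΛ_add, symbolΛ_add]
  nlinarith [mul_le_mul_of_nonneg_left hle (symbolΛ_pos s ζ).le]

/-- The frequency-interaction inequality, in terms of `a = ⟨ξ₁⟩²`, `b = ⟨ξ₂⟩²`, `c = ⟨ξ₁ + ξ₂⟩²`.
The larger of `a` and `b` dominates `c`, and the remaining powers are put on the smaller one. -/
theorem rpow_le_of_le_add {a b c s θ : ℝ} (ha : 1 ≤ a) (hb : 1 ≤ b) (hc : 0 ≤ c)
    (hcab : c ≤ 2 * a + 2 * b) (hs : 0 ≤ s) (hθ : 0 ≤ θ) :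
    c ^ s ≤ 4 ^ s * (a ^ (-(s + θ)) + b ^ (-(s + θ))) * (a ^ s * b ^ (s + θ)) := by
  have ha0 : 0 < a := by linarith
  have hb0 : 0 < b := by linarith
  rw [mul_assoc]
  rcases le_total a b with h | h
  · calc c ^ s ≤ (4 * b) ^ s := Real.rpow_le_rpow hc (by linarith) hs
      _ = 4 ^ s * b ^ s := Real.mul_rpow (by norm_num) hb0.le
      _ ≤ 4 ^ s * (a ^ (-(s + θ)) * (a ^ s * b ^ (s + θ))) := by
          gcongr
          have : a ^ (-(s + θ)) * (a ^ s * b ^ (s + θ)) = b ^ s * (a ^ (-θ) * b ^ θ) := by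
            rw [← mul_assoc, ← Real.rpow_add ha0, Real.rpow_add hb0,
              show -(s + θ) + s = -θ by ring]
            ring
          rw [this]
          refine le_mul_of_one_le_right (by positivity) ?_
          rw [Real.rpow_neg ha0.le, inv_mul_eq_div, one_le_div (by positivity)]
          exact Real.rpow_le_rpow ha0.le h hθ
      _ ≤ _ := by
          gcongr
          exact le_add_of_nonneg_right (by positivity)
  · calc c ^ s ≤ (4 * a) ^ s := Real.rpow_le_rpow hc (by linarith) hs
      _ = 4 ^ s * (b ^ (-(s + θ)) * (a ^ s * b ^ (s + θ))) := by
          rw [Real.mul_rpow (by norm_num) ha0.le, Real.rpow_neg hb0.le]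
          field_simp
      _ ≤ _ := by
          gcongr
          exact le_add_of_nonneg_left (by positivity)

theorem one_add_spaceSq_add_le (η ω : Spacetime) :
    1 + spaceSq (η + ω) ≤ 2 * (1 + spaceSq η) + 2 * (1 + spaceSq ω) := by
  simp only [spaceSq, PiLp.add_apply]
  nlinarith [sq_nonneg (η 1 - ω 1), sq_nonneg (η 2 - ω 2)]

/-- The square of the convolution kernel that dominates the product
`H^{s,θ} · H^{s+θ,0} → H^{s,0}`. -/
def kernelSq (s θ : ℝ) (η ω : Spacetime) : ℝ :=
  4 ^ s * coneWeight η ^ (-θ) * ((1 + spaceSq η) ^ (-(s + θ)) + (1 + spaceSq ω) ^ (-(s + θ)))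

theorem symbolΛ_add_sq_le {s θ : ℝ} (hs : 0 ≤ s) (hθ : 0 ≤ θ) (η ω : Spacetime) :
    symbolΛ s (η + ω) ^ 2 ≤
      kernelSq s θ η ω * ((symbolΛ s η * symbolΛminus θ η) ^ 2 * symbolΛ (s + θ) ω ^ 2) := by
  have hη := spaceSq_nonneg η
  have hω := spaceSq_nonneg ω
  have hw : 0 < coneWeight η := zero_lt_one.trans_le (one_le_coneWeight η)
  rw [mul_pow, symbolΛ_sq, symbolΛ_sq, symbolΛ_sq, symbolΛminus_sq]
  refine (rpow_le_of_le_add (by linarith) (by linarith) (by linarith [spaceSq_nonneg (η + ω)])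
    (one_add_spaceSq_add_le η ω) hs hθ).trans_eq ?_
  rw [kernelSq, Real.rpow_neg hw.le]
  field_simp

end SymbolInequalities

/-! ### Uniform square integrability of the kernel -/

section Integrals

theorem lintegral_one_add_norm_sq_rpow_lt_top {E : Type*} [NormedAddCommGroup E] [NormedSpace ℝ E]
    [FiniteDimensional ℝ E] [MeasurableSpace E] [BorelSpace E] {μ : Measure E} [μ.IsAddHaarMeasure]
    {r : ℝ} (hr : (Module.finrank ℝ E : ℝ) < 2 * r) :
    ∫⁻ x, ENNReal.ofReal ((1 + ‖x‖ ^ 2) ^ (-r)) ∂μ < ∞ := by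
  have := integrable_rpow_neg_one_add_norm_sq (E := E) (μ := μ) hr
  rw [show -(2 * r) / 2 = -r by ring] at this
  exact this.lintegral_lt_top

/-- The spatial part `ξ` of a frequency. -/
def spacePart (ζ : Spacetime) : EuclideanSpace ℝ (Fin 2) := WithLp.toLp 2 (Fin.tail ζ.ofLp)

theorem spaceSq_eq_norm_sq (ζ : Spacetime) : spaceSq ζ = ‖spacePart ζ‖ ^ 2 := by
  rw [EuclideanSpace.real_norm_sq_eq, Fin.sum_univ_two]
  rfl

/-- The frequency with time part `t` and spatial part `y`. -/
def ofTimeSpace (t : ℝ) (y : EuclideanSpace ℝ (Fin 2)) : Spacetime :=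
  WithLp.toLp 2 (Fin.cons t y.ofLp)

theorem lintegral_spacetime {f : Spacetime → ℝ≥0∞} (hf : Measurable f) :
    ∫⁻ ζ, f ζ = ∫⁻ y, ∫⁻ t, f (ofTimeSpace t y) := by
  have e1 := (EuclideanSpace.volume_preserving_symm_measurableEquiv_toLp (Fin 3)).symm
  have e2 := (EuclideanSpace.volume_preserving_symm_measurableEquiv_toLp (Fin 2))
  have e3 := (volume_preserving_piFinSuccAbove (fun _ : Fin 3 => ℝ) 0).symm
  have m1 : Measurable fun z : Fin 3 → ℝ => f (WithLp.toLp 2 z) :=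
    hf.comp (MeasurableEquiv.toLp 2 (Fin 3 → ℝ)).measurable
  have hcons : ⇑(MeasurableEquiv.piFinSuccAbove (fun _ : Fin 3 => ℝ) 0).symm =
      fun p : ℝ × (Fin 2 → ℝ) => (Fin.cons p.1 p.2 : Fin 3 → ℝ) :=
    funext fun p => Fin.insertNth_zero' p.1 p.2
  rw [hcons] at e3
  have m2 : Measurable fun p : ℝ × (Fin 2 → ℝ) => f (WithLp.toLp 2 (Fin.cons p.1 p.2)) :=
    m1.comp e3.measurable
  calc ∫⁻ ζ, f ζ = ∫⁻ z : Fin 3 → ℝ, f (WithLp.toLp 2 z) := (e1.lintegral_comp hf).symm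
    _ = ∫⁻ p : ℝ × (Fin 2 → ℝ), f (WithLp.toLp 2 (Fin.cons p.1 p.2)) :=
      (e3.lintegral_comp m1).symm
    _ = ∫⁻ z : Fin 2 → ℝ, ∫⁻ t : ℝ, f (WithLp.toLp 2 (Fin.cons t z)) := by
      rw [Measure.volume_eq_prod, lintegral_prod_symm _ m2.aemeasurable]
    _ = _ := (e2.lintegral_comp_emb (MeasurableEquiv.measurableEmbedding _) fun z =>
      ∫⁻ t : ℝ, f (WithLp.toLp 2 (Fin.cons t z))).symm

/-- The lower half of the comparison of `coneWeight` with `1 + (|τ| - |ξ|)²`.  It rests on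
`(τ² - |ξ|²)² ≥ (|τ| - |ξ|)² (τ² + |ξ|²)`. -/
theorem one_add_sq_le_two_mul_coneWeight (ζ : Spacetime) :
    1 + (|ζ 0| - ‖spacePart ζ‖) ^ 2 ≤ 2 * coneWeight ζ := by
  have hT : timeSq ζ = |ζ 0| ^ 2 := (sq_abs _).symm
  rw [coneWeight, spaceSq_eq_norm_sq, hT]
  have ha := abs_nonneg (ζ 0)
  have hb := norm_nonneg (spacePart ζ)
  generalize |ζ 0| = a at *
  generalize ‖spacePart ζ‖ = b at *
  have hp : 0 < 1 + a ^ 2 + b ^ 2 := by positivity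
  have hd : (a - b) ^ 2 ≤ a ^ 2 + b ^ 2 := by nlinarith [mul_nonneg ha hb]
  have hq : (a - b) ^ 2 * (a ^ 2 + b ^ 2) ≤ (a ^ 2 - b ^ 2) ^ 2 := by
    rw [show (a ^ 2 - b ^ 2) ^ 2 = (a - b) ^ 2 * (a + b) ^ 2 by ring]
    gcongr
    nlinarith [mul_nonneg ha hb]
  have : (a - b) ^ 2 * (a ^ 2 + b ^ 2) / (1 + a ^ 2 + b ^ 2) ≤
      (a ^ 2 - b ^ 2) ^ 2 / (1 + a ^ 2 + b ^ 2) := by gcongr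
  suffices h : (1 + (a - b) ^ 2) / 2 - 1 ≤
      (a - b) ^ 2 * (a ^ 2 + b ^ 2) / (1 + a ^ 2 + b ^ 2) by linarith
  rw [le_div_iff₀ hp]
  nlinarith

/-- A bound for `Λ₋^{-2θ}` by two one-dimensional profiles, centred at the two sheets `t = ±‖y‖` of
the light cone.  The factor `2π` only makes the left side smaller. -/
theorem coneWeight_rpow_le {θ : ℝ} (hθ : 0 ≤ θ) (t : ℝ) (y : EuclideanSpace ℝ (Fin 2)) :
    coneWeight ((2 * Real.pi) • ofTimeSpace t y) ^ (-θ) ≤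
      2 ^ θ * ((1 + ‖t - ‖y‖‖ ^ 2) ^ (-θ) + (1 + ‖t + ‖y‖‖ ^ 2) ^ (-θ)) := by
  have h := one_add_sq_le_two_mul_coneWeight ((2 * Real.pi) • ofTimeSpace t y)
  have hpi : 1 ≤ 2 * Real.pi := by linarith [Real.pi_gt_three]
  have h0 : |((2 * Real.pi) • ofTimeSpace t y) 0| = 2 * Real.pi * |t| := by
    change |2 * Real.pi * t| = _
    rw [abs_mul, abs_of_pos (by positivity)]
  have h1 : ‖spacePart ((2 * Real.pi) • ofTimeSpace t y)‖ = 2 * Real.pi * ‖y‖ := by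
    change ‖(2 * Real.pi) • y‖ = _
    rw [norm_smul, Real.norm_of_nonneg (by positivity)]
  rw [h0, h1, ← mul_sub, mul_pow] at h
  have h2 : 1 + (|t| - ‖y‖) ^ 2 ≤ 2 * coneWeight ((2 * Real.pi) • ofTimeSpace t y) := by
    nlinarith [sq_nonneg (|t| - ‖y‖), one_le_pow₀ (n := 2) hpi]
  have h3 : coneWeight ((2 * Real.pi) • ofTimeSpace t y) ^ (-θ) ≤
      2 ^ θ * (1 + (|t| - ‖y‖) ^ 2) ^ (-θ) := by
    calc _ ≤ ((1 + (|t| - ‖y‖) ^ 2) / 2) ^ (-θ) :=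
          Real.rpow_le_rpow_of_nonpos (by positivity) (by linarith) (by linarith)
      _ = _ := by
          rw [Real.div_rpow (by positivity) (by norm_num), Real.rpow_neg (x := 2) (by norm_num),
            div_inv_eq_mul, mul_comm]
  refine h3.trans (mul_le_mul_of_nonneg_left ?_ (by positivity))
  simp only [Real.norm_eq_abs, sq_abs]
  rcases abs_cases t with ⟨e, -⟩ | ⟨e, -⟩ <;> rw [e]
  · exact le_add_of_nonneg_right (by positivity)
  · rw [show (-t - ‖y‖) ^ 2 = (t + ‖y‖) ^ 2 by ring]
    exact le_add_of_nonneg_left (by positivity)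

/-- The inverse weight `Λ₋^{-2θ}` is integrable in the time frequency, uniformly in the spatial
frequency; this is where `θ > 1/2` enters. -/
theorem exists_lintegral_coneWeight_le {θ : ℝ} (hθ : 1 / 2 < θ) :
    ∃ M : ℝ≥0, ∀ y : EuclideanSpace ℝ (Fin 2),
      ∫⁻ t, ENNReal.ofReal (coneWeight ((2 * Real.pi) • ofTimeSpace t y) ^ (-θ)) ≤ M := by
  have hI : ∫⁻ t : ℝ, ENNReal.ofReal ((1 + ‖t‖ ^ 2) ^ (-θ)) < ∞ :=
    lintegral_one_add_norm_sq_rpow_lt_top (by simp; linarith)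
  set I := ∫⁻ t : ℝ, ENNReal.ofReal ((1 + ‖t‖ ^ 2) ^ (-θ)) with hIdef
  refine ⟨(ENNReal.ofReal (2 ^ θ) * (I + I)).toNNReal, fun y => ?_⟩
  rw [ENNReal.coe_toNNReal (by finiteness)]
  calc _ ≤ ∫⁻ t : ℝ, ENNReal.ofReal (2 ^ θ) * (ENNReal.ofReal ((1 + ‖t - ‖y‖‖ ^ 2) ^ (-θ)) +
        ENNReal.ofReal ((1 + ‖t + ‖y‖‖ ^ 2) ^ (-θ))) := by
        refine lintegral_mono fun t => ?_
        rw [← ENNReal.ofReal_add (by positivity) (by positivity),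
          ← ENNReal.ofReal_mul (by positivity)]
        exact ENNReal.ofReal_le_ofReal (coneWeight_rpow_le (by linarith) t y)
    _ = _ := by
        rw [lintegral_const_mul _ (by fun_prop), lintegral_add_left (by fun_prop),
          lintegral_sub_right_eq_self (fun t : ℝ => ENNReal.ofReal ((1 + ‖t‖ ^ 2) ^ (-θ))),
          lintegral_add_right_eq_self (fun t : ℝ => ENNReal.ofReal ((1 + ‖t‖ ^ 2) ^ (-θ)))]

theorem continuous_coneWeight : Continuous coneWeight := by
  unfold coneWeight timeSq spaceSq
  refine continuous_const.add (Continuous.div (by fun_prop) (by fun_prop) fun ζ => ?_)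
  positivity

theorem measurable_symbolΛ (α : ℝ) : Measurable (symbolΛ α) := by
  unfold symbolΛ spaceSq
  fun_prop

theorem measurable_symbolΛminus (α : ℝ) : Measurable (symbolΛminus α) :=
  continuous_coneWeight.measurable.pow_const (α / 2)

theorem measurable_symbolDplus : Measurable symbolDplus := by
  unfold symbolDplus timeSq spaceSq
  fun_prop

theorem measurable_symbolDminus : Measurable symbolDminus := by
  unfold symbolDminus timeSq spaceSq
  simp_rw [← Real.norm_eq_abs]
  fun_prop

theorem continuous_spacePart : Continuous spacePart :=
  (PiLp.continuous_toLp 2 _).comp <| continuous_pi fun i => by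
    change Continuous fun ζ : Spacetime => ζ i.succ
    fun_prop

/-- The kernel is square integrable in its first variable, uniformly in the frequency of the
product.  In the spatial frequency this uses `s + θ > 1`, half the dimension. -/
theorem exists_lintegral_kernelSq_le {s θ : ℝ} (hθ : 1 / 2 < θ) (hsθ : 1 < s + θ) :
    ∃ M : ℝ≥0, ∀ ζ : Spacetime, ∫⁻ η, ENNReal.ofReal
      (kernelSq s θ ((2 * Real.pi) • η) ((2 * Real.pi) • (ζ - η))) ≤ M := by
  obtain ⟨M, hM⟩ := exists_lintegral_coneWeight_le hθ
  let h : EuclideanSpace ℝ (Fin 2) → ℝ≥0∞ := fun y => ENNReal.ofReal ((1 + ‖y‖ ^ 2) ^ (-(s + θ)))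
  have hm : Measurable h := by fun_prop
  have hI : ∫⁻ y, h y < ∞ := lintegral_one_add_norm_sq_rpow_lt_top (by simp; linarith)
  set I := ∫⁻ y, h y with hIdef
  refine ⟨(ENNReal.ofReal (4 ^ s) * (I + I) * M).toNNReal, fun ζ => ?_⟩
  rw [ENNReal.coe_toNNReal (by finiteness)]
  have hb (ω : Spacetime) : (1 + spaceSq ((2 * Real.pi) • ω)) ^ (-(s + θ)) ≤
      (1 + ‖spacePart ω‖ ^ 2) ^ (-(s + θ)) := by
    refine Real.rpow_le_rpow_of_nonpos (by positivity) ?_ (by linarith)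
    rw [← spaceSq_eq_norm_sq]
    have : spaceSq ((2 * Real.pi) • ω) = (2 * Real.pi) ^ 2 * spaceSq ω := by
      simp only [spaceSq, PiLp.smul_apply, smul_eq_mul]
      ring
    rw [this]
    have hpi : 1 ≤ 2 * Real.pi := by linarith [Real.pi_gt_three]
    nlinarith [spaceSq_nonneg ω, one_le_pow₀ (n := 2) hpi]
  have hw (η : Spacetime) : 0 ≤ coneWeight η := zero_le_one.trans (one_le_coneWeight η)
  have hcw : Measurable fun η : Spacetime =>
      ENNReal.ofReal (coneWeight ((2 * Real.pi) • η) ^ (-θ)) := by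
    have := (continuous_coneWeight.comp (continuous_const_smul (2 * Real.pi))).measurable
    exact (this.pow_const (-θ)).ennreal_ofReal
  have hsp := continuous_spacePart.measurable
  calc _ ≤ ∫⁻ η, ENNReal.ofReal (4 ^ s) *
        (ENNReal.ofReal (coneWeight ((2 * Real.pi) • η) ^ (-θ)) *
        (h (spacePart η) + h (spacePart ζ - spacePart η))) := by
        refine lintegral_mono fun η => ?_
        have := hw ((2 * Real.pi) • η)
        rw [← ENNReal.ofReal_add (by positivity) (by positivity),
          ← ENNReal.ofReal_mul (by positivity), ← ENNReal.ofReal_mul (by positivity)]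
        refine ENNReal.ofReal_le_ofReal ?_
        rw [kernelSq, mul_assoc]
        have h2 := add_le_add (hb η) (hb (ζ - η))
        exact mul_le_mul_of_nonneg_left (mul_le_mul_of_nonneg_left h2 (by positivity))
          (by positivity)
    _ = ENNReal.ofReal (4 ^ s) * ∫⁻ y, ∫⁻ t,
        ENNReal.ofReal (coneWeight ((2 * Real.pi) • ofTimeSpace t y) ^ (-θ)) *
        (h y + h (spacePart ζ - y)) := by
        rw [lintegral_const_mul _ (by fun_prop), lintegral_spacetime (by fun_prop)]
        rfl
    _ ≤ ENNReal.ofReal (4 ^ s) * ∫⁻ y, (h y + h (spacePart ζ - y)) * M := by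
        gcongr with y
        rw [lintegral_mul_const' _ _ (by finiteness), mul_comm]
        gcongr
        exact hM y
    _ = _ := by
        rw [lintegral_mul_const _ (by fun_prop), lintegral_add_left hm,
          lintegral_sub_left_eq_self h, mul_assoc]

end Integrals

/-! ### The bilinear estimate on the Fourier side -/

section BilinearEstimate

/-- Cauchy–Schwarz for a convolution with a kernel `k`, in squared form. -/
theorem lintegral_sq_le_of_sq_le_kernel_mul {k U : Spacetime → Spacetime → ℝ≥0∞}
    {P Q : Spacetime → ℝ≥0∞} {M : ℝ≥0∞} (hk : ∀ ζ, Measurable (k ζ)) (hP : Measurable P)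
    (hQ : Measurable Q) (hU : ∀ ζ η, U ζ η ^ 2 ≤ k ζ η * (P η * Q (ζ - η)))
    (hM : ∀ ζ, ∫⁻ η, k ζ η ≤ M) :
    ∫⁻ ζ, (∫⁻ η, U ζ η) ^ 2 ≤ M * ((∫⁻ η, P η) * ∫⁻ ω, Q ω) := by
  have hle (ζ : Spacetime) : (∫⁻ η, U ζ η) ^ 2 ≤ M * ∫⁻ η, P η * Q (ζ - η) := by
    have hU' (η : Spacetime) :
        U ζ η ≤ k ζ η ^ (1 / 2 : ℝ) * (P η * Q (ζ - η)) ^ (1 / 2 : ℝ) := by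
      rw [← ENNReal.mul_rpow_of_nonneg _ _ (by norm_num), one_div, ENNReal.le_rpow_inv_iff
        (by norm_num)]
      exact_mod_cast hU ζ η
    have h := (lintegral_mono hU').trans (ENNReal.lintegral_mul_norm_pow_le (μ := volume)
      (f := k ζ) (g := fun η => P η * Q (ζ - η)) (hk ζ).aemeasurable (by fun_prop)
      (by norm_num) (by norm_num) (by norm_num))
    rw [← ENNReal.mul_rpow_of_nonneg _ _ (by norm_num), one_div, ENNReal.le_rpow_inv_iff
      (by norm_num)] at h
    refine le_trans (by exact_mod_cast h) ?_
    gcongr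
    exact hM ζ
  calc _ ≤ ∫⁻ ζ, M * ∫⁻ η, P η * Q (ζ - η) := lintegral_mono hle
    _ = M * ∫⁻ ζ, ∫⁻ η, P η * Q (ζ - η) := by
        refine lintegral_const_mul _ ?_
        exact Measurable.lintegral_prod_right' (f := fun p : Spacetime × Spacetime =>
          P p.2 * Q (p.1 - p.2)) (by fun_prop)
    _ = M * ∫⁻ η, ∫⁻ ζ, P η * Q (ζ - η) := by
        rw [lintegral_lintegral_swap]
        exact Measurable.aemeasurable (by fun_prop)
    _ = _ := by
        congr 1
        rw [← lintegral_mul_const _ hP]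
        refine lintegral_congr fun η => ?_
        rw [lintegral_const_mul _ (by fun_prop), lintegral_sub_right_eq_self]

/-- The product estimate `H^{s,θ} · H^{s+θ,0} → H^{s,0}` on the Fourier side. -/
theorem exists_lintegral_convolution_le {s θ : ℝ} (hs : 0 ≤ s) (hθ : 1 / 2 < θ)
    (hsθ : 1 < s + θ) :
    ∃ M : ℝ≥0, ∀ F G : Spacetime → ℂ, Measurable F → Measurable G →
      ∫⁻ ζ, ‖(symbolΛ s ((2 * Real.pi) • ζ) : ℂ) * ∫ η, F η * G (ζ - η)‖ₑ ^ 2 ≤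
        M * ((∫⁻ η, ‖((symbolΛ s ((2 * Real.pi) • η) *
            symbolΛminus θ ((2 * Real.pi) • η) : ℝ) : ℂ) * F η‖ₑ ^ 2) *
          ∫⁻ ω, ‖(symbolΛ (s + θ) ((2 * Real.pi) • ω) : ℂ) * G ω‖ₑ ^ 2) := by
  obtain ⟨M, hM⟩ := exists_lintegral_kernelSq_le (s := s) hθ hsθ
  refine ⟨M, fun F G hF hG => ?_⟩
  have hkm (ζ : Spacetime) : Measurable fun η : Spacetime => ENNReal.ofReal
      (kernelSq s θ ((2 * Real.pi) • η) ((2 * Real.pi) • (ζ - η))) := by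
    have h1 := continuous_coneWeight.measurable
    have h2 : Measurable spaceSq := by unfold spaceSq; fun_prop
    unfold kernelSq
    fun_prop
  have m1 := measurable_symbolΛ s
  have m2 := measurable_symbolΛ (s + θ)
  have m3 := measurable_symbolΛminus θ
  refine le_trans (lintegral_mono fun ζ => ?_) (lintegral_sq_le_of_sq_le_kernel_mul
    (U := fun ζ η => ‖(symbolΛ s ((2 * Real.pi) • ζ) : ℂ) * (F η * G (ζ - η))‖ₑ)
    hkm (by fun_prop) (by fun_prop) (fun ζ η => ?_) hM)
  · gcongr
    rw [← integral_const_mul]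
    exact enorm_integral_le_lintegral_enorm _
  · have h := ENNReal.ofReal_le_ofReal
      (symbolΛ_add_sq_le hs (by linarith) ((2 * Real.pi) • η) ((2 * Real.pi) • (ζ - η)))
    rw [← smul_add, add_sub_cancel, ENNReal.ofReal_mul', ENNReal.ofReal_mul (by positivity),
      ENNReal.ofReal_pow (symbolΛ_pos _ _).le, ENNReal.ofReal_pow (symbolΛ_pos _ _).le,
      ENNReal.ofReal_pow (mul_pos (symbolΛ_pos _ _) (symbolΛminus_pos _ _)).le] at h
    · have hn {r : ℝ} (hr : 0 < r) : ‖(r : ℂ)‖ₑ = ENNReal.ofReal r := by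
        rw [← ofReal_norm, Complex.norm_real, Real.norm_of_nonneg hr.le]
      simp only [enorm_mul, hn (symbolΛ_pos _ _),
        hn (mul_pos (symbolΛ_pos _ _) (symbolΛminus_pos _ _)), mul_pow]
      refine (mul_le_mul_left h _).trans_eq ?_
      ring
    · positivity

end BilinearEstimate

/-! ### The Sobolev norms on the Fourier side -/

section Norms

variable {u : 𝓢'(Spacetime, ℂ)} {g : Spacetime → ℂ}

theorem enorm_eq_eLpNorm_fourier (f : Lp ℂ 2 (volume : Measure Spacetime)) :
    ‖f‖ₑ = eLpNorm (𝓕 f : Lp ℂ 2 (volume : Measure Spacetime)) 2 volume := by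
  rw [← Lp.enorm_def, ← ofReal_norm, ← ofReal_norm, Lp.norm_fourier_eq]

/-- If `û` is a function, the Fourier-side `L²` norm is bounded by `‖u‖_{H^{s,θ}}` (the two are in
fact equal): every competitor in the infimum has this norm, by uniqueness of the density and
Plancherel. -/
theorem HasFourierDensity.eLpNorm_le_normH (h : HasFourierDensity u g) (s θ : ℝ) :
    eLpNorm (fun ζ => ((symbolΛ s ((2 * Real.pi) • ζ) * symbolΛminus θ ((2 * Real.pi) • ζ) : ℝ) :
      ℂ) * g ζ) 2 volume ≤ normH s θ u := by
  refine le_iInf₂ fun f ⟨g', hg', hf⟩ => ?_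
  rw [enorm_eq_eLpNorm_fourier]
  refine (eLpNorm_congr_ae ?_).le
  filter_upwards [h.ae_eq hg', hf.ae_eq (hasFourierDensity_ofL2 f)] with ζ h1 h2
  rw [← h2, h1]

theorem exists_hasFourierDensity_of_normH_lt_top {s θ : ℝ} (h : normH s θ u < ∞) :
    ∃ g, HasFourierDensity u g := by
  simp only [normH, iInf_lt_iff] at h
  obtain ⟨f, ⟨g, hg, -⟩, -⟩ := h
  exact ⟨g, hg⟩

/-- A multiplier whose Fourier-side image is square integrable produces an `L²` function. -/
theorem HasFourierDensity.exists_isMultiplierImage (h : HasFourierDensity u g) {m : Spacetime → ℝ}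
    (hm : MemLp (fun ζ => (m ((2 * Real.pi) • ζ) : ℂ) * g ζ) 2 volume) :
    ∃ f : Lp ℂ 2 (volume : Measure Spacetime), IsMultiplierImage m u (ofL2 f) ∧
      (𝓕 f : Lp ℂ 2 (volume : Measure Spacetime)) =ᵐ[volume]
        fun ζ => (m ((2 * Real.pi) • ζ) : ℂ) * g ζ := by
  have h0 : (𝓕 (𝓕⁻ hm.toLp : Lp ℂ 2 (volume : Measure Spacetime)) :
      Lp ℂ 2 (volume : Measure Spacetime)) = hm.toLp := FourierTransform.fourier_fourierInv_eq _
  have hae : (𝓕 (𝓕⁻ hm.toLp : Lp ℂ 2 (volume : Measure Spacetime)) :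
      Lp ℂ 2 (volume : Measure Spacetime)) =ᵐ[volume]
        fun ζ => (m ((2 * Real.pi) • ζ) : ℂ) * g ζ := by
    rw [h0]
    exact hm.coeFn_toLp
  exact ⟨𝓕⁻ hm.toLp, ⟨g, h, (hasFourierDensity_ofL2 _).congr hae⟩, hae⟩

theorem HasFourierDensity.normH_le_eLpNorm (h : HasFourierDensity u g) {s θ : ℝ}
    (hm : MemLp (fun ζ => ((symbolΛ s ((2 * Real.pi) • ζ) *
      symbolΛminus θ ((2 * Real.pi) • ζ) : ℝ) : ℂ) * g ζ) 2 volume) :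
    normH s θ u ≤ eLpNorm (fun ζ => ((symbolΛ s ((2 * Real.pi) • ζ) *
      symbolΛminus θ ((2 * Real.pi) • ζ) : ℝ) : ℂ) * g ζ) 2 volume := by
  obtain ⟨f, hf, hae⟩ :=
    h.exists_isMultiplierImage (m := fun ζ => symbolΛ s ζ * symbolΛminus θ ζ) hm
  refine (iInf₂_le f hf).trans_eq ?_
  rw [enorm_eq_eLpNorm_fourier, eLpNorm_congr_ae hae]

/-- A multiplier dominated by `Λ^{s+1} Λ₋^θ + Λ^s Λ₋^θ |τ|` maps `𝓗^{s+1,θ}` to `L²`. -/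
theorem HasFourierDensity.eLpNorm_le_normCalH (h : HasFourierDensity u g) {s θ : ℝ}
    {m : Spacetime → ℝ}
    (hm : ∀ ζ, |m ζ| ≤
      symbolΛ (s + 1) ζ * symbolΛminus θ ζ + symbolΛ s ζ * symbolΛminus θ ζ * |ζ 0|) :
    eLpNorm (fun ζ => (m ((2 * Real.pi) • ζ) : ℂ) * g ζ) 2 volume ≤ normCalH (s + 1) θ u := by
  have hΛ (α : ℝ) := measurable_symbolΛ α
  have hΛm := measurable_symbolΛminus θ
  have e1 := h.eLpNorm_le_normH (s + 1) θ
  have e2 := h.timeDeriv.eLpNorm_le_normH s θ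
  rw [normCalH, add_sub_cancel_right]
  refine le_trans ?_ (add_le_add e1 e2)
  rw [← eLpNorm_norm, ← eLpNorm_norm (fun ζ => _ * (Complex.I * _ * g ζ))]
  have a1 : AEStronglyMeasurable (fun ζ => ((symbolΛ (s + 1) ((2 * Real.pi) • ζ) *
      symbolΛminus θ ((2 * Real.pi) • ζ) : ℝ) : ℂ) * g ζ) volume :=
    (Measurable.aestronglyMeasurable (by fun_prop)).mul h.1
  have a2 : AEStronglyMeasurable (fun ζ => ((symbolΛ s ((2 * Real.pi) • ζ) *
      symbolΛminus θ ((2 * Real.pi) • ζ) : ℝ) : ℂ) *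
        (Complex.I * ((2 * Real.pi * ζ 0 : ℝ) : ℂ) * g ζ)) volume :=
    (Measurable.aestronglyMeasurable (by fun_prop)).mul h.timeDeriv.1
  rw [← eLpNorm_norm (fun ζ => ((symbolΛ (s + 1) _ * _ : ℝ) : ℂ) * g ζ)]
  refine le_trans (eLpNorm_mono_real fun ζ => ?_) (eLpNorm_add_le a1.norm a2.norm one_le_two)
  have h1 := symbolΛ_pos (s + 1) ((2 * Real.pi) • ζ)
  have h2 := symbolΛ_pos s ((2 * Real.pi) • ζ)
  have h3 := symbolΛminus_pos θ ((2 * Real.pi) • ζ)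
  have h4 := mul_le_mul_of_nonneg_right (hm ((2 * Real.pi) • ζ)) (norm_nonneg (g ζ))
  -- The multiplier `τ` produced by `∂_t` is the angular frequency at which the symbols are taken.
  have h5 : ((2 * Real.pi) • ζ) 0 = 2 * Real.pi * ζ 0 := rfl
  rw [h5] at h4
  simp only [Pi.add_apply, norm_mul, Complex.norm_real, Complex.norm_I, one_mul,
    Real.norm_eq_abs, abs_of_pos h1, abs_of_pos h2, abs_of_pos h3, abs_mul,
    abs_abs, abs_norm] at h4 ⊢
  linarith

end Norms

theorem eLpNorm_two_sq {f : Spacetime → ℂ} :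
    eLpNorm f 2 volume ^ 2 = ∫⁻ ζ, ‖f ζ‖ₑ ^ 2 := by
  have := eLpNorm_nnreal_pow_eq_lintegral (μ := (volume : Measure Spacetime)) (f := f) (p := 2)
    two_ne_zero
  simpa only [ENNReal.coe_ofNat, NNReal.coe_ofNat, ENNReal.rpow_ofNat] using this

end WaveSobolev

end

theorem mainTheorem4 (s θ ε : ℝ) (hs : 0 < s) (hθ : max (1 / 2) (1 - s) < θ) (hθ1 : θ < 1)
    (hε : 0 ≤ ε) (hε1 : ε ≤ 1 - θ) :
    ∃ C : ℝ≥0, 0 < C ∧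
      ∀ φ ψ : 𝓢'(WaveSobolev.Spacetime, ℂ),
        WaveSobolev.normCalH (s + 1) θ φ < ∞ → WaveSobolev.normCalH (s + 1) θ ψ < ∞ →
          ∃ f g : Lp ℂ 2 (volume : Measure WaveSobolev.Spacetime),
            WaveSobolev.IsMultiplierImage WaveSobolev.symbolDplus φ (WaveSobolev.ofL2 f) ∧
            WaveSobolev.IsMultiplierImage WaveSobolev.symbolDminus ψ (WaveSobolev.ofL2 g) ∧
            WaveSobolev.normH s (θ - 1 + ε) (WaveSobolev.mulL2 f g) ≤
              C * WaveSobolev.normCalH (s + 1) θ φ * WaveSobolev.normCalH (s + 1) θ ψ := by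
  open WaveSobolev in
  obtain ⟨hθ2, hsθ⟩ := max_lt_iff.1 hθ
  have hθ0 : 0 < θ := by linarith
  obtain ⟨M, hM⟩ := exists_lintegral_convolution_le hs.le hθ2 (s := s) (by linarith)
  -- `M + 1` is positive and its square dominates `M`.
  refine ⟨M + 1, by positivity, fun φ ψ hφ hψ => ?_⟩
  obtain ⟨a, ha⟩ := exists_hasFourierDensity_of_normH_lt_top (le_self_add.trans_lt hφ)
  obtain ⟨b, hb⟩ := exists_hasFourierDensity_of_normH_lt_top (le_self_add.trans_lt hψ)
  have hweighted (ζ : Spacetime) : |symbolΛ s ζ * symbolΛminus θ ζ * symbolDplus ζ| ≤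
      symbolΛ (s + 1) ζ * symbolΛminus θ ζ + symbolΛ s ζ * symbolΛminus θ ζ * |ζ 0| := by
    rw [abs_of_nonneg (mul_nonneg (mul_pos (symbolΛ_pos _ _) (symbolΛminus_pos _ _)).le
      (symbolDplus_nonneg ζ))]
    exact symbol_mul_symbolDplus_le s θ ζ
  have hweighted' (ζ : Spacetime) : |symbolΛ (s + θ) ζ * symbolDminus ζ| ≤
      symbolΛ (s + 1) ζ * symbolΛminus θ ζ + symbolΛ s ζ * symbolΛminus θ ζ * |ζ 0| := by
    rw [abs_of_nonneg (mul_nonneg (symbolΛ_pos _ _).le (symbolDminus_nonneg ζ))]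
    exact symbolΛ_mul_symbolDminus_le s hθ0.le hθ1.le ζ
  have hplus (ζ : Spacetime) : |symbolDplus ζ| ≤
      symbolΛ (s + 1) ζ * symbolΛminus θ ζ + symbolΛ s ζ * symbolΛminus θ ζ * |ζ 0| := by
    refine le_trans ?_ (hweighted ζ)
    rw [abs_mul]
    refine le_mul_of_one_le_left (abs_nonneg _) ((one_le_mul_of_one_le_of_one_le ?_ ?_).trans
      (le_abs_self _))
    · exact one_le_symbolΛ hs.le ζ
    · exact one_le_symbolΛminus hθ0.le ζ
  have hminus (ζ : Spacetime) : |symbolDminus ζ| ≤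
      symbolΛ (s + 1) ζ * symbolΛminus θ ζ + symbolΛ s ζ * symbolΛminus θ ζ * |ζ 0| := by
    refine le_trans ?_ (hweighted' ζ)
    rw [abs_mul]
    exact le_mul_of_one_le_left (abs_nonneg _)
      ((one_le_symbolΛ (by linarith) ζ).trans (le_abs_self _))
  have mplus := measurable_symbolDplus
  have mminus := measurable_symbolDminus
  obtain ⟨f, hf, hfa⟩ := ha.exists_isMultiplierImage (m := symbolDplus)
    ⟨(Measurable.aestronglyMeasurable (by fun_prop)).mul ha.1,
      (ha.eLpNorm_le_normCalH hplus).trans_lt hφ⟩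
  obtain ⟨g, hg, hgb⟩ := hb.exists_isMultiplierImage (m := symbolDminus)
    ⟨(Measurable.aestronglyMeasurable (by fun_prop)).mul hb.1,
      (hb.eLpNorm_le_normCalH hminus).trans_lt hψ⟩
  refine ⟨f, g, hf, hg, ?_⟩
  have hfg := hasFourierDensity_mulL2 f g
  have hf_le : ∫⁻ η, ‖((symbolΛ s ((2 * Real.pi) • η) *
      symbolΛminus θ ((2 * Real.pi) • η) : ℝ) : ℂ) *
      (𝓕 f : Lp ℂ 2 (volume : Measure Spacetime)) η‖ₑ ^ 2 ≤ normCalH (s + 1) θ φ ^ 2 := by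
    rw [← eLpNorm_two_sq]
    gcongr
    refine le_trans (eLpNorm_congr_ae ?_).le (ha.eLpNorm_le_normCalH hweighted)
    filter_upwards [hfa] with ζ hζ
    rw [hζ]
    push_cast
    ring
  have hg_le : ∫⁻ η, ‖(symbolΛ (s + θ) ((2 * Real.pi) • η) : ℂ) *
      (𝓕 g : Lp ℂ 2 (volume : Measure Spacetime)) η‖ₑ ^ 2 ≤ normCalH (s + 1) θ ψ ^ 2 := by
    rw [← eLpNorm_two_sq]
    gcongr
    refine le_trans (eLpNorm_congr_ae ?_).le (hb.eLpNorm_le_normCalH hweighted')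
    filter_upwards [hgb] with ζ hζ
    rw [hζ]
    push_cast
    ring
  have hest := hM _ _ (Lp.stronglyMeasurable (𝓕 f : Lp ℂ 2 (volume : Measure Spacetime))).measurable
    (Lp.stronglyMeasurable (𝓕 g : Lp ℂ 2 (volume : Measure Spacetime))).measurable
  -- The exponent `θ - 1 + ε` is nonpositive, so `Λ₋^{θ-1+ε}` can be dropped.
  have hle : eLpNorm (fun ζ => ((symbolΛ s ((2 * Real.pi) • ζ) *
      symbolΛminus (θ - 1 + ε) ((2 * Real.pi) • ζ) : ℝ) : ℂ) *
      ∫ η, (𝓕 f : Lp ℂ 2 (volume : Measure Spacetime)) η *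
        (𝓕 g : Lp ℂ 2 (volume : Measure Spacetime)) (ζ - η)) 2 volume ≤
      (M + 1 : ℝ≥0) * normCalH (s + 1) θ φ * normCalH (s + 1) θ ψ := by
    refine le_trans (eLpNorm_mono (g := fun ζ => (symbolΛ s ((2 * Real.pi) • ζ) : ℂ) *
      ∫ η, (𝓕 f : Lp ℂ 2 (volume : Measure Spacetime)) η *
        (𝓕 g : Lp ℂ 2 (volume : Measure Spacetime)) (ζ - η)) fun ζ => ?_) ?_
    · rw [norm_mul, norm_mul, Complex.norm_real, Complex.norm_real, norm_mul]
      refine mul_le_mul_of_nonneg_right (mul_le_of_le_one_right (norm_nonneg _) ?_) (norm_nonneg _)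
      rw [Real.norm_of_nonneg (symbolΛminus_pos _ _).le]
      exact symbolΛminus_le_one (by linarith) _
    · rw [← ENNReal.pow_le_pow_left_iff two_ne_zero, eLpNorm_two_sq]
      refine hest.trans ?_
      rw [mul_assoc, mul_pow, mul_pow]
      gcongr
      have : M ≤ (M + 1) ^ 2 := by nlinarith [M.2, sq_nonneg M]
      exact_mod_cast this
  have hfin : (M + 1 : ℝ≥0) * normCalH (s + 1) θ φ * normCalH (s + 1) θ ψ < ∞ :=
    ENNReal.mul_lt_top (ENNReal.mul_lt_top ENNReal.coe_lt_top hφ) hψ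
  have ms := measurable_symbolΛ s
  have mm := measurable_symbolΛminus (θ - 1 + ε)
  exact (hfg.normH_le_eLpNorm ⟨(Measurable.aestronglyMeasurable (by fun_prop)).mul hfg.1,
    hle.trans_lt hfin⟩).trans hle
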